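/- **Proposition (Generalization comparison for explicit decoupling).** Let $d_L,d_H,N\ge 1$ and $0\le k_L<d_L$ be integers, put $d=d_L+d_H$, and let $A\ge 1$, $B>0$, $\delta\in(0,1)$. (In the intended application $k_L$ is the intrinsic dimension of a manifold near which the clean low-frequency component $l$ concentrates.) Let $z=(l_t,h_t,l,h)\in\mathbb R^{d_L}\times\mathbb R^{d_H}\times\mathbb R^{d_L}\times\mathbb R^{d_H}$ be a random data point with law $P$ (noisy low/high-frequency sub-states and clean low/high-frequency components), and let $S=(z_1,\dots,z_N)$ be i.i.d. with law $P$, with empirical measure $P_N$. Consider arbitrary classes of measurable predictors $$\mathcal F_{\rm dir}^L\subset\{\mathbb R^{d}\to\mathbb R^{d_L}\},\quad \mathcal F_{\rm dir}^H\subset\{\mathbb R^{d}\to\mathbb R^{d_H}\},\quad \mathcal F_{\rm dec}^L\subset\{\mathbb R^{d_L}\to\mathbb R^{d_L}\},\quad \mathcal F_{\rm dec}^H\subset\{\mathbb R^{d_L}\times\mathbb R^{d_H}\to\mathbb R^{d_H}\},$$ and $\mathcal F_{\rm dir}=\mathcal F_{\rm dir}^L\times\mathcal F_{\rm dir}^H$,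 $\mathcal F_{\rm dec}=\mathcal F_{\rm dec}^L\times\mathcal F_{\rm dec}^H$. Assume that almost surely $\|l\|_\infty,\|h\|_\infty\le B$ and that the outputs $f_L(l_t,h_t)$, $f_H(l_t,h_t)$, $g_L(l_t)$, $g_H(l,h_t)$ of all predictors in these classes have sup norm at most $B$ almost surely. Let $\ell_L(\hat l,l)=\|\hat l-l\|_2^2/(4B^2d_L)$ and $\ell_H(\hat h,h)=\|\hat h-h\|_2^2/(4B^2d_H)$ (so the losses lie in $[0,1]$), and let the loss classes be $$\mathcal G_{\rm dir}^L=\{z\mapsto\ell_L(f_L(l_t,h_t),l)\},\quad \mathcal G_{\rm dir}^H=\{z\mapsto\ell_H(f_H(l_t,h_t),h)\},\quad \mathcal G_{\rm dec}^L=\{z\mapsto\ell_L(g_L(l_t),l)\},\quad \mathcal G_{\rm dec}^H=\{z\mapsto\ell_H(g_H(l,h_t),h)\},$$ with $f_L,f_H,g_L,g_H$ ranging over the corresponding class. Assume that each of the four classes is pointwise separable, i.e. has a countable subclass such that every member is the pointwise limit of a sequence in the subclass (this holds, for instance, if the loss class has a finite-dimensional parameterization with respect to which the loss is Lipschitz,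 uniformly in $z$). Assume finally that almost surely, for all $\varepsilon\in(0,1]$, $$\log\mathcal N(\varepsilon,\mathcal G,L_2(P_N))\le m_{\mathcal G}\log(A/\varepsilon),\qquad m_{\mathcal G_{\rm dir}^L}=m_{\mathcal G_{\rm dir}^H}=d,\quad m_{\mathcal G_{\rm dec}^L}=d_L,\quad m_{\mathcal G_{\rm dec}^H}=k_L+d_H,$$ where $\mathcal N(\varepsilon,\mathcal G,L_2(P_N))$ is the least number of closed $L_2(P_N)$-balls of radius $\varepsilon$, with arbitrary centers, that cover $\mathcal G$. Define the risks $R_{\rm dir}(f)=\mathbb E[\ell_L(f_L(l_t,h_t),l)]+\mathbb E[\ell_H(f_H(l_t,h_t),h)]$ for $f=(f_L,f_H)$ and $R_{\rm dec}(g_L,g_H)=\mathbb E[\ell_L(g_L(l_t),l)]+\mathbb E[\ell_H(g_H(l,h_t),h)]$, and let $\widehat R_{\rm dir}$, $\widehat R_{\rm dec}$ be their empirical counterparts on $S$ (replace $\mathbb E$ by the average over $z_1,\dots,z_N$). Then with probability at least $1-\delta$ the following hold simultaneously for all $f\in\mathcal F_{\rm dir}$ and all $(g_L,g_H)\in\mathcal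 F_{\rm dec}$: $$R_{\rm dir}(f)\le\widehat R_{\rm dir}(f)+\frac{24A\sqrt{\pi d}}{\sqrt N}+3\sqrt{\frac{2\log(8/\delta)}{N}},$$ $$R_{\rm dec}(g_L,g_H)\le\widehat R_{\rm dec}(g_L,g_H)+\frac{12A\sqrt\pi}{\sqrt N}\bigl(\sqrt{d_L}+\sqrt{k_L+d_H}\bigr)+3\sqrt{\frac{2\log(8/\delta)}{N}}.$$ Moreover the decoupled complexity term is strictly smaller than the direct one: $$\frac{12A\sqrt\pi}{\sqrt N}\bigl(\sqrt{d_L}+\sqrt{k_L+d_H}\bigr)<\frac{24A\sqrt{\pi d}}{\sqrt N}.$$ -/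

import Mathlib

open MeasureTheory ProbabilityTheory Filter Topology
open scoped NNReal ENNReal

noncomputable section

namespace Decoupling

/-- Euclidean space `ℝⁿ`. -/
abbrev Vec (n : ℕ) : Type := EuclideanSpace ℝ (Fin n)

/-- A pair of sub-states (low-frequency part, high-frequency part), i.e. a point of
`ℝ^(dL + dH)` written in wavelet coordinates. -/
abbrev State (dL dH : ℕ) : Type := Vec dL × Vec dH

/-- A data point `z = (l_t, h_t, l, h)`: the noisy state followed by the clean state. -/
abbrev Sample (dL dH : ℕ) : Type := State dL dH × State dL dH

section Coordinates

variable {dL dH : ℕ}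

/-- The noisy low-frequency sub-state `l_t`. -/
def Sample.lt (z : Sample dL dH) : Vec dL := z.1.1

/-- The noisy high-frequency sub-state `h_t`. -/
def Sample.ht (z : Sample dL dH) : Vec dH := z.1.2

/-- The clean low-frequency component `l`. -/
def Sample.l (z : Sample dL dH) : Vec dL := z.2.1

/-- The clean high-frequency component `h`. -/
def Sample.h (z : Sample dL dH) : Vec dH := z.2.2

end Coordinates

/-- The sup norm `‖x‖_∞ = max_i |x_i|` on `ℝⁿ`. -/
def supNorm {n : ℕ} (x : Vec n) : ℝ := ‖WithLp.ofLp x‖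

/-- The normalized squared loss `‖u - v‖₂² / (4 B² n)` on `ℝⁿ`. -/
def normLoss (B : ℝ) {n : ℕ} (u v : Vec n) : ℝ := ‖u - v‖ ^ 2 / (4 * B ^ 2 * n)

section Losses

variable {dL dH : ℕ}

/-- `z ↦ ℓ_L(f_L(l_t, h_t), l)`. -/
def lossDirL (B : ℝ) (fL : State dL dH → Vec dL) (z : Sample dL dH) : ℝ :=
  normLoss B (fL (Sample.lt z, Sample.ht z)) (Sample.l z)

/-- `z ↦ ℓ_H(f_H(l_t, h_t), h)`. -/
def lossDirH (B : ℝ) (fH : State dL dH → Vec dH) (z : Sample dL dH) : ℝ :=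
  normLoss B (fH (Sample.lt z, Sample.ht z)) (Sample.h z)

/-- `z ↦ ℓ_L(g_L(l_t), l)`. -/
def lossDecL (B : ℝ) (gL : Vec dL → Vec dL) (z : Sample dL dH) : ℝ :=
  normLoss B (gL (Sample.lt z)) (Sample.l z)

/-- `z ↦ ℓ_H(g_H(l, h_t), h)`: the high branch sees the clean `l` (teacher forcing). -/
def lossDecH (B : ℝ) (gH : Vec dL × Vec dH → Vec dH) (z : Sample dL dH) : ℝ :=
  normLoss B (gH (Sample.l z, Sample.ht z)) (Sample.h z)

end Losses

section Risks

variable {X : Type*}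

/-- The true risk `𝔼_{z ∼ P} ℓ(z)` of a loss function. -/
def risk [MeasurableSpace X] (P : Measure X) (loss : X → ℝ) : ℝ := ∫ z, loss z ∂P

/-- The empirical risk `(1/N) ∑ᵢ ℓ(zᵢ)` of a loss function. -/
def empRisk {N : ℕ} (S : Fin N → X) (loss : X → ℝ) : ℝ := (∑ i, loss (S i)) / N

variable {dL dH N : ℕ}

/-- `R_dir(f) = R_dir^L(f_L) + R_dir^H(f_H)`. -/
def riskDir (B : ℝ) (P : Measure (Sample dL dH))
    (f : (State dL dH → Vec dL) × (State dL dH → Vec dH)) : ℝ :=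
  risk P (lossDirL B f.1) + risk P (lossDirH B f.2)

/-- The empirical counterpart of `riskDir`. -/
def empRiskDir (B : ℝ) (S : Fin N → Sample dL dH)
    (f : (State dL dH → Vec dL) × (State dL dH → Vec dH)) : ℝ :=
  empRisk S (lossDirL B f.1) + empRisk S (lossDirH B f.2)

/-- `R_dec(g_L, g_H) = R_dec^L(g_L) + R_dec^H(g_H)`. -/
def riskDec (B : ℝ) (P : Measure (Sample dL dH))
    (g : (Vec dL → Vec dL) × (Vec dL × Vec dH → Vec dH)) : ℝ :=
  risk P (lossDecL B g.1) + risk P (lossDecH B g.2)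

/-- The empirical counterpart of `riskDec`. -/
def empRiskDec (B : ℝ) (S : Fin N → Sample dL dH)
    (g : (Vec dL → Vec dL) × (Vec dL × Vec dH → Vec dH)) : ℝ :=
  empRisk S (lossDecL B g.1) + empRisk S (lossDecH B g.2)

end Risks

section Covering

variable {X : Type*} {N : ℕ}

/-- The function `g` as an element of `L²(P_N)`, `P_N` the empirical measure of `S`: the vector of
its values on the sample scaled by `1/√N`, so that the Euclidean distance of two such vectors is
the `L²(P_N)` distance of the functions (see `dist_toL2Emp`). -/
def toL2Emp (S : Fin N → X) (g : X → ℝ) : EuclideanSpace ℝ (Fin N) :=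
  WithLp.toLp 2 fun i => g (S i) / √N

theorem dist_toL2Emp (S : Fin N → X) (g g' : X → ℝ) :
    dist (toL2Emp S g) (toL2Emp S g') = √((∑ i, (g (S i) - g' (S i)) ^ 2) / N) := by
  rw [EuclideanSpace.dist_eq]
  congr 1
  rw [Finset.sum_div]
  refine Finset.sum_congr rfl fun i _ => ?_
  simp only [toL2Emp, Real.dist_eq, sq_abs]
  rw [← sub_div, div_pow, Real.sq_sqrt (Nat.cast_nonneg N)]

/-- The covering number `𝒩(ε, G, L²(P_N))`: the least number of closed `L²(P_N)`-balls of radius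
`ε` (with arbitrary centers) that cover `G`; it is `⊤` if no finite number suffices. -/
def coveringNumber (ε : ℝ≥0) (G : Set (X → ℝ)) (S : Fin N → X) : ℕ∞ :=
  Metric.externalCoveringNumber ε (toL2Emp S '' G)

/-- The growth condition `log 𝒩(ε, G, L²(P_N)) ≤ m log (A/ε)` for every `ε ∈ (0, 1]`.
The logarithm takes values in the extended reals, so the condition contains finiteness. -/
def EntropyGrowth (A : ℝ) (m : ℕ) (G : Set (X → ℝ)) (S : Fin N → X) : Prop :=
  ∀ ε : ℝ≥0, 0 < ε → ε ≤ 1 →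
    ENNReal.log (coveringNumber ε G S : ℝ≥0∞) ≤ ((m * Real.log (A / ε) : ℝ) : EReal)

/-- `G` is pointwise separable: it has a countable subclass such that every member of `G` is the
pointwise limit of a sequence in the subclass. This is the usual measurability condition for
uniform laws over an uncountable class. -/
def PointwiseSeparable (G : Set (X → ℝ)) : Prop :=
  ∃ G₀ ⊆ G, G₀.Countable ∧
    ∀ g ∈ G, ∃ u : ℕ → X → ℝ, (∀ n, u n ∈ G₀) ∧ ∀ x, Tendsto (fun n => u n x) atTop (𝓝 (g x))

/-- A class with a finite-dimensional parameterization that is uniformly Lipschitz in the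
parameter is pointwise separable. -/
theorem pointwiseSeparable_of_lipschitz {m : ℕ} (Θ : Set (Vec m)) (F : Vec m → X → ℝ) (C : ℝ≥0)
    (hF : ∀ x, LipschitzOnWith C (fun θ => F θ x) Θ) : PointwiseSeparable (F '' Θ) := by
  obtain ⟨D, hDc, hDd⟩ := TopologicalSpace.exists_countable_dense Θ
  refine ⟨(fun θ : Θ => F θ) '' D, ?_, hDc.image _, ?_⟩
  · rintro _ ⟨θ, _, rfl⟩
    exact ⟨θ, θ.2, rfl⟩
  · rintro _ ⟨θ, hθ, rfl⟩
    obtain ⟨v, hv, hlim⟩ := mem_closure_iff_seq_limit.1 (hDd ⟨θ, hθ⟩)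
    refine ⟨fun n => F (v n), fun n => ⟨v n, hv n, rfl⟩, fun x => ?_⟩
    have hc : Continuous (fun θ : Θ => F θ x) :=
      continuousOn_iff_continuous_domRestrict.1 (hF x).continuousOn
    exact (hc.tendsto ⟨θ, hθ⟩).comp hlim

end Covering

end Decoupling

end

/-! Each of the four loss classes gets its own one-sided uniform law with failure probability `δ /
4` (`exists_event_risk_le`); a union bound and addition of the two branches give the risk bounds.

For one class, the largest gap between true and empirical risk moves by at most `1 / N` when one
data point changes, so it concentrates above its mean (`measureReal_ge_le_of_boundedDifferences`).
Comparison with a ghost sample bounds the mean by a Rademacher average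
(`integral_uniformDeviation_le`). Dyadic chaining bounds that average: nets of size `(A 2^j)^m` at
scale `2^-j` contribute order `√m (1 + log A + j) 2^-j`, a summable series
(`signAvg_iSup_signForm_le_of_cover`).

These estimates concern finite families, with constants independent of the number of members.
Continuity of measure from below extends them to a sequence, and pointwise separability with
dominated convergence to the whole class.

The complexity enters only through `√m`. Both decoupled exponents, `dL` and `kL + dH`, lie strictly
below `dL + dH`, whence the strict comparison. -/

noncomputable section

namespace Decoupling

/-! ### Rademacher averages and Massart's lemma -/

section Signs

variable {N : ℕ}

/-- The real sign encoded by a Boolean. -/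
def boolSign (b : Bool) : ℝ := if b then 1 else -1

/-- The average of `F` over all sign patterns of length `N`. -/
def signAvg (F : (Fin N → Bool) → ℝ) : ℝ := (∑ s, F s) / 2 ^ N

/-- The signed sum `∑ᵢ sᵢ xᵢ`. -/
def signForm (s : Fin N → Bool) (x : EuclideanSpace ℝ (Fin N)) : ℝ := ∑ i, boolSign (s i) * x i

theorem abs_boolSign (b : Bool) : |boolSign b| = 1 := by cases b <;> simp [boolSign]

theorem signAvg_mono {F G : (Fin N → Bool) → ℝ} (h : ∀ s, F s ≤ G s) : signAvg F ≤ signAvg G := by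
  unfold signAvg
  gcongr with s
  exact h s

theorem signAvg_add (F G : (Fin N → Bool) → ℝ) :
    signAvg (fun s => F s + G s) = signAvg F + signAvg G := by
  simp [signAvg, Finset.sum_add_distrib, add_div]

theorem signAvg_sum {κ : Type*} (C : Finset κ) (F : κ → (Fin N → Bool) → ℝ) :
    signAvg (fun s => ∑ k ∈ C, F k s) = ∑ k ∈ C, signAvg (F k) := by
  simp only [signAvg]
  rw [Finset.sum_comm, Finset.sum_div]

theorem signAvg_const_mul (c : ℝ) (F : (Fin N → Bool) → ℝ) :
    signAvg (fun s => c * F s) = c * signAvg F := by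
  simp [signAvg, ← Finset.mul_sum, mul_div_assoc]

@[simp]
theorem signAvg_const (c : ℝ) : signAvg (fun _ : Fin N → Bool => c) = c := by
  simp [signAvg]

theorem signForm_add (s : Fin N → Bool) (x y : EuclideanSpace ℝ (Fin N)) :
    signForm s (x + y) = signForm s x + signForm s y := by
  simp [signForm, mul_add, Finset.sum_add_distrib]

@[simp]
theorem signForm_zero (s : Fin N → Bool) : signForm s 0 = 0 := by simp [signForm]

theorem signForm_le (s : Fin N → Bool) (x : EuclideanSpace ℝ (Fin N)) :
    signForm s x ≤ N * ‖x‖ := by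
  have h : ∀ i ∈ (Finset.univ : Finset (Fin N)), boolSign (s i) * x i ≤ ‖x‖ := fun i _ => by
    refine (le_abs_self _).trans ?_
    rw [abs_mul, abs_boolSign, one_mul]
    exact PiLp.norm_apply_le x i
  simpa [signForm] using Finset.sum_le_card_nsmul _ _ _ h

/-- Moment generating function of a Rademacher sum. -/
theorem signAvg_exp_signForm_le (t : ℝ) (x : EuclideanSpace ℝ (Fin N)) :
    signAvg (fun s => Real.exp (t * signForm s x)) ≤ Real.exp (t ^ 2 * ‖x‖ ^ 2 / 2) := by
  -- The signs are independent, so the average of the product of exponentials is the product of the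
  -- one-sign averages, each a `cosh`.
  have h1 : signAvg (fun s => Real.exp (t * signForm s x)) = ∏ i, Real.cosh (t * x i) := by
    have : ∀ i, Real.cosh (t * x i)
        = (∑ b : Bool, Real.exp (t * (boolSign b * x i))) / 2 := fun i => by
      simp [Real.cosh_eq, boolSign]
    simp_rw [this, Finset.prod_div_distrib, Finset.prod_univ_sum, signAvg, signForm,
      Finset.mul_sum, Real.exp_sum, Fintype.piFinset_univ]
    simp
  rw [h1, EuclideanSpace.norm_sq_eq, Finset.mul_sum, Finset.sum_div, Real.exp_sum]
  refine Finset.prod_le_prod (fun i _ => (Real.cosh_pos _).le) fun i _ => ?_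
  refine (Real.cosh_le_exp_half_sq _).trans_eq ?_
  simp [mul_pow]

/-- Massart's finite class lemma, before optimization over the exponential parameter. -/
theorem signAvg_iSup_signForm_le {ι : Type*} [Finite ι] [Nonempty ι]
    (a : ι → EuclideanSpace ℝ (Fin N)) (C : Finset (EuclideanSpace ℝ (Fin N)))
    (haC : ∀ i, a i ∈ C) {r t L : ℝ} (hr : ∀ i, ‖a i‖ ≤ r) (ht : 0 < t)
    (hC : (C.card : ℝ) ≤ Real.exp L) :
    signAvg (fun s => ⨆ i, signForm s (a i)) ≤ L / t + t * r ^ 2 / 2 := by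
  classical
  have hr0 : 0 ≤ r := (norm_nonneg _).trans (hr (Classical.arbitrary ι))
  -- `exp Q` bounds the sum over `C` of the moment generating functions. The tangent inequality `y +
  -- 1 ≤ exp y` at `y = t * sup - Q` then replaces Jensen's inequality. Members of `C` longer than
  -- `r` are discarded, since their moments are not controlled.
  set Q : ℝ := L + t ^ 2 * r ^ 2 / 2 with hQ
  have hpt : ∀ s : Fin N → Bool, t * (⨆ i, signForm s (a i)) ≤
      (Q - 1) + Real.exp (-Q) * ∑ x ∈ C with ‖x‖ ≤ r, Real.exp (t * signForm s x) := fun s => by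
    obtain ⟨i, hi⟩ := exists_eq_ciSup_of_finite (f := fun i => signForm s (a i))
    rw [← hi]
    have h1 := Real.add_one_le_exp (t * signForm s (a i) - Q)
    have h2 : Real.exp (t * signForm s (a i)) ≤
        ∑ x ∈ C with ‖x‖ ≤ r, Real.exp (t * signForm s x) :=
      Finset.single_le_sum (f := fun x => Real.exp (t * signForm s x))
        (fun _ _ => (Real.exp_pos _).le) (Finset.mem_filter.2 ⟨haC i, hr i⟩)
    have h3 := mul_le_mul_of_nonneg_left h2 (Real.exp_pos (-Q)).le
    rw [← Real.exp_add, neg_add_eq_sub] at h3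
    linarith
  have h := signAvg_mono hpt
  rw [signAvg_const_mul, signAvg_add, signAvg_const, signAvg_const_mul, signAvg_sum] at h
  have hsum : ∑ x ∈ C with ‖x‖ ≤ r, signAvg (fun s => Real.exp (t * signForm s x))
      ≤ Real.exp Q := by
    calc _ ≤ ∑ x ∈ C with ‖x‖ ≤ r, Real.exp (t ^ 2 * r ^ 2 / 2) :=
          Finset.sum_le_sum fun x hx => (signAvg_exp_signForm_le t x).trans <| by
            have := (Finset.mem_filter.1 hx).2
            gcongr
      _ ≤ (C.card : ℝ) * Real.exp (t ^ 2 * r ^ 2 / 2) := by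
          rw [Finset.sum_const, nsmul_eq_mul]
          gcongr
          exact Finset.filter_subset _ _
      _ ≤ Real.exp Q := by
          rw [hQ, Real.exp_add]
          gcongr
  have h4 : Real.exp (-Q) * ∑ x ∈ C with ‖x‖ ≤ r,
      signAvg (fun s => Real.exp (t * signForm s x)) ≤ 1 := by
    refine (mul_le_mul_of_nonneg_left hsum (Real.exp_pos _).le).trans_eq ?_
    rw [← Real.exp_add]; simp
  have h5 : t * signAvg (fun s => ⨆ i, signForm s (a i)) ≤ Q := by linarith
  rw [mul_comm, ← le_div_iff₀ ht] at h5
  refine h5.trans_eq ?_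
  rw [hQ]; field_simp

end Signs

/-! ### Dyadic chaining and the entropy bound -/

section Chaining

variable {N : ℕ}

/-- Sums the chaining series; the value tends to `α + 2 * β` and, for nonnegative `α` and `β`, stays
below it. -/
theorem sum_range_affine_div_two_pow (α β : ℝ) (J : ℕ) :
    ∑ j ∈ Finset.range J, (α + β * (j + 1)) / 2 ^ (j + 1)
      = α * (1 - 1 / 2 ^ J) + β * (2 - (J + 2) / 2 ^ J) := by
  induction J with
  | zero => simp
  | succ J ih =>
    rw [Finset.sum_range_succ, ih]
    push_cast
    field_simp
    ring

theorem ciSup_add_le_of_finite {ι : Type*} [Finite ι] [Nonempty ι] (f g : ι → ℝ) :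
    ⨆ i, (f i + g i) ≤ (⨆ i, f i) + ⨆ i, g i :=
  ciSup_le fun i => add_le_add (le_ciSup (Set.finite_range f).bddAbove i)
    (le_ciSup (Set.finite_range g).bddAbove i)

theorem signAvg_iSup_signForm_add_le {ι : Type*} [Finite ι] [Nonempty ι]
    (a b : ι → EuclideanSpace ℝ (Fin N)) :
    signAvg (fun s => ⨆ i, signForm s (a i + b i)) ≤
      signAvg (fun s => ⨆ i, signForm s (a i)) + signAvg (fun s => ⨆ i, signForm s (b i)) := by
  rw [← signAvg_add]
  refine signAvg_mono fun s => ?_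
  simp_rw [signForm_add]
  exact ciSup_add_le_of_finite _ _

/-- Bound along the first `J` links of a chain of dyadic approximations that starts at `0`. -/
theorem signAvg_iSup_chain_le {ι : Type*} [Finite ι] [Nonempty ι] {m : ℕ} (hm : 0 < m) {a : ℝ}
    (p : ℕ → ι → EuclideanSpace ℝ (Fin N)) (T : ι → EuclideanSpace ℝ (Fin N))
    (C : ℕ → Finset (EuclideanSpace ℝ (Fin N))) (hp0 : ∀ i, p 0 i = 0)
    (hpC : ∀ j i, p j i ∈ C j) (hpT : ∀ j i, ‖p j i - T i‖ ≤ 1 / 2 ^ j)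
    (hC : ∀ j, ((C j).card : ℝ) ≤ Real.exp (m * (a + j * Real.log 2))) (J : ℕ) :
    signAvg (fun s => ⨆ i, signForm s (p J i)) ≤
      √m * ∑ j ∈ Finset.range J, ((2 * a + 9 / 2) + (2 * Real.log 2) * (j + 1)) / 2 ^ (j + 1) := by
  classical
  induction J with
  | zero => simp [hp0]
  | succ J ih =>
    have hm' : 0 < √(m : ℝ) := Real.sqrt_pos.2 (by exact_mod_cast hm)
    have hlog : 0 < Real.log 2 := Real.log_pos (by norm_num)
    have hstep : signAvg (fun s => ⨆ i, signForm s (p (J + 1) i - p J i)) ≤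
        √m * (((2 * a + 9 / 2) + (2 * Real.log 2) * (J + 1)) / 2 ^ (J + 1)) := by
      have hr : ∀ i, ‖p (J + 1) i - p J i‖ ≤ 3 / 2 ^ (J + 1) := fun i => by
        have h1 := hpT (J + 1) i
        have h2 := hpT J i
        have h3 : ‖p (J + 1) i - p J i‖ ≤ ‖p (J + 1) i - T i‖ + ‖p J i - T i‖ := by
          rw [← dist_eq_norm, ← dist_eq_norm, ← dist_eq_norm]
          exact dist_triangle_right _ _ _
        refine (h3.trans (add_le_add h1 h2)).trans_eq ?_
        field_simp
        ring
      -- A link is a difference of points of two consecutive nets, so the two entropies add; the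
      -- bound gives away one `log 2` in the exponent per unit of `m`.
      have hcard : ((Finset.image₂ (fun x y => x - y) (C (J + 1)) (C J)).card : ℝ) ≤
          Real.exp (m * (2 * a + (2 * Real.log 2) * (J + 1))) := by
        calc _ ≤ (((C (J + 1)).card * (C J).card : ℕ) : ℝ) := by
              exact_mod_cast Finset.card_image₂_le _ _ _
          _ ≤ Real.exp (m * (a + (J + 1 : ℕ) * Real.log 2)) *
              Real.exp (m * (a + J * Real.log 2)) := by
              push_cast
              have := hC (J + 1)
              push_cast at this
              exact mul_le_mul this (hC J) (by positivity) (by positivity)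
          _ ≤ _ := by
              rw [← Real.exp_add, Real.exp_le_exp, ← mul_add]
              refine mul_le_mul_of_nonneg_left ?_ (Nat.cast_nonneg m)
              push_cast
              linarith
      -- With this `t`, the entropy term is `√m` times the exponent per unit of `m`, over `2 ^ (J +
      -- 1)`. The variance term with `r = 3 / 2 ^ (J + 1)` is `√m * (9 / 2) / 2 ^ (J + 1)`, the
      -- source of the constant `9 / 2`.
      refine (signAvg_iSup_signForm_le _ _ (fun i => Finset.mem_image₂_of_mem (hpC (J + 1) i)
        (hpC J i)) hr (t := √m * 2 ^ (J + 1)) (by positivity) hcard).trans_eq ?_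
      have hmm : (m : ℝ) = √m * √m := (Real.mul_self_sqrt (Nat.cast_nonneg m)).symm
      rw [hmm, Real.sqrt_mul_self hm'.le]
      field_simp
      ring
    have h := signAvg_iSup_signForm_add_le (fun i => p J i) (fun i => p (J + 1) i - p J i)
    simp only [add_sub_cancel] at h
    rw [Finset.sum_range_succ, mul_add]
    linarith

/-- Dudley's entropy bound for a finite family in the unit ball with polynomial covering numbers. -/
theorem signAvg_iSup_signForm_le_of_cover {ι : Type*} [Finite ι] [Nonempty ι] {m : ℕ} (hm : 0 < m)
    {A : ℝ} (hA : 1 ≤ A) (T : ι → EuclideanSpace ℝ (Fin N)) (hT : ∀ i, ‖T i‖ ≤ 1)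
    (hcov : ∀ j : ℕ, ∃ C : Finset (EuclideanSpace ℝ (Fin N)),
      (C.card : ℝ) ≤ Real.exp (m * (Real.log A + j * Real.log 2)) ∧
        ∀ i, ∃ x ∈ C, ‖x - T i‖ ≤ 1 / 2 ^ j) :
    signAvg (fun s => ⨆ i, signForm s (T i)) ≤ 6 * A * √(Real.pi * m) := by
  choose C hCcard q hqC hqT using hcov
  have hlogA : 0 ≤ Real.log A := Real.log_nonneg hA
  have hlog2 : 0 < Real.log 2 := Real.log_pos (by norm_num)
  -- The net at level `0` is replaced by `{0}`: the family lies in the unit ball, so `0` is a net of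
  -- radius `1`, and the chain starts with zero signed sum.
  have hchain := signAvg_iSup_chain_le hm (a := Real.log A)
    (fun j i => if j = 0 then 0 else q j i) T (fun j => if j = 0 then {0} else C j)
    (by simp) (fun j i => by by_cases hj : j = 0 <;> simp [hj, hqC])
    (fun j i => by
      by_cases hj : j = 0
      · simpa [hj] using hT i
      · simpa [hj] using hqT j i)
    (fun j => by
      by_cases hj : j = 0
      · simp [hj]; positivity
      · simpa [hj] using hCcard j)
  -- By `log A ≤ A - 1` the bracket is at most `2 * A + 5.3`, below `10.2 * A ≤ 6 * A * √π` because
  -- `A ≥ 1`.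
  have hfin : √(m : ℝ) * (2 * Real.log A + 9 / 2 + 4 * Real.log 2) ≤ 6 * A * √(Real.pi * m) := by
    rw [Real.sqrt_mul Real.pi_pos.le]
    have h1 : (17 / 10 : ℝ) ≤ √Real.pi := by
      apply Real.le_sqrt_of_sq_le
      have := Real.pi_gt_three
      linarith
    have h2 := Real.log_le_sub_one_of_pos (by linarith : 0 < A)
    have h3 := Real.log_two_lt_d9
    have h4 : 2 * Real.log A + 9 / 2 + 4 * Real.log 2 ≤ 6 * A * √Real.pi := by nlinarith
    nlinarith [mul_le_mul_of_nonneg_left h4 (Real.sqrt_nonneg (m : ℝ))]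
  -- Stopping at level `J` leaves a remainder of norm at most `2^-J`, whose signed sum is trivially
  -- at most `N * 2^-J`. As `N` is fixed, this vanishes as `J` grows.
  have hJ : ∀ J : ℕ, signAvg (fun s => ⨆ i, signForm s (T i)) ≤
      6 * A * √(Real.pi * m) + N * (1 / 2 : ℝ) ^ J := fun J => by
    have h := signAvg_iSup_signForm_add_le (fun i => if J = 0 then 0 else q J i)
      (fun i => T i - if J = 0 then 0 else q J i)
    simp only [add_sub_cancel] at h
    have hrest : signAvg (fun s => ⨆ i, signForm s (T i - if J = 0 then 0 else q J i)) ≤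
        N * (1 / 2 : ℝ) ^ J := by
      rw [← signAvg_const (N := N) (N * (1 / 2 : ℝ) ^ J)]
      refine signAvg_mono fun s => ciSup_le fun i => (signForm_le s _).trans ?_
      gcongr
      rw [norm_sub_rev, one_div_pow]
      by_cases hj : J = 0
      · simpa [hj] using hT i
      · simpa [hj] using hqT J i
    have hs := hchain J
    rw [sum_range_affine_div_two_pow] at hs
    have hs' : (2 * Real.log A + 9 / 2) * (1 - 1 / 2 ^ J)
        + 2 * Real.log 2 * (2 - ((J : ℝ) + 2) / 2 ^ J)
        ≤ 2 * Real.log A + 9 / 2 + 4 * Real.log 2 := by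
      have e1 : 0 ≤ (2 * Real.log A + 9 / 2) * (1 / 2 ^ J) := by positivity
      have e2 : 0 ≤ 2 * Real.log 2 * (((J : ℝ) + 2) / 2 ^ J) := by positivity
      linarith
    have := mul_le_mul_of_nonneg_left hs' (Real.sqrt_nonneg (m : ℝ))
    linarith
  refine ge_of_tendsto' (x := atTop) ?_ hJ
  have := (tendsto_pow_atTop_nhds_zero_of_lt_one (r := (1 / 2 : ℝ)) (by norm_num)
    (by norm_num)).const_mul (N : ℝ)
  simpa using this.const_add (6 * A * √(Real.pi * m))

end Chaining

theorem abs_ciSup_le {ι : Type*} [Finite ι] [Nonempty ι] {f : ι → ℝ} {K : ℝ}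
    (h : ∀ i, |f i| ≤ K) : |⨆ i, f i| ≤ K := by
  obtain ⟨i, hi⟩ := exists_eq_ciSup_of_finite (f := f)
  rw [← hi]
  exact h i

theorem integrable_of_abs_le {Y : Type*} [MeasurableSpace Y] {ν : Measure Y} [IsFiniteMeasure ν]
    {f : Y → ℝ} (hf : Measurable f) {K : ℝ} (hK : ∀ y, |f y| ≤ K) : Integrable f ν :=
  Integrable.of_bound hf.aestronglyMeasurable K (Eventually.of_forall hK)

/-! ### Bounded differences inequality -/

section McDiarmid

variable {X : Type*} [MeasurableSpace X]

/-- Splits off the first coordinate, for the induction on the number of variables. -/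
theorem integral_pi_succ (P : Measure X) [IsProbabilityMeasure P] {n : ℕ}
    {g : (Fin (n + 1) → X) → ℝ} (hg : Measurable g) {K : ℝ} (hK : ∀ x, |g x| ≤ K) :
    ∫ x, g x ∂(Measure.pi fun _ => P) =
      ∫ a, ∫ y, g (Fin.cons a y) ∂(Measure.pi fun _ : Fin n => P) ∂P := by
  have h := (measurePreserving_piFinSuccAbove (fun _ : Fin (n + 1) => P) 0).symm
  have hcons : ∀ z : X × (Fin n → X),
      (MeasurableEquiv.piFinSuccAbove (fun _ => X) 0).symm z = Fin.cons z.1 z.2 := fun z => by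
    simp [MeasurableEquiv.piFinSuccAbove, Fin.insertNthEquiv]
  rw [← h.integral_comp', integral_prod]
  · simp only [hcons]
  · exact integrable_of_abs_le (hg.comp (MeasurableEquiv.measurable _)) fun _ => hK _

theorem measurable_finCons {n : ℕ} :
    Measurable fun z : X × (Fin n → X) => (Fin.cons z.1 z.2 : Fin (n + 1) → X) := by
  refine measurable_pi_iff.2 fun i => ?_
  induction i using Fin.cases with
  | zero => simpa using measurable_fst
  | succ i => exact (measurable_pi_apply i).comp measurable_snd

/-- Exponential moment bound for functions with bounded differences of independent variables. -/
theorem integral_exp_le_of_boundedDifferences (P : Measure X) [IsProbabilityMeasure P] {c : ℝ}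
    (t : ℝ) (n : ℕ) (f : (Fin n → X) → ℝ) (hf : Measurable f) {K : ℝ} (hK : ∀ x, |f x| ≤ K)
    (hc : ∀ x i a, f (Function.update x i a) ≤ f x + c) :
    ∫ x, Real.exp (t * f x) ∂(Measure.pi fun _ => P) ≤
      Real.exp (t * (∫ x, f x ∂(Measure.pi fun _ => P)) + n * (c ^ 2 * t ^ 2 / 2)) := by
  induction n with
  | zero =>
    have h : ∀ x, f x = f default := fun x => congrArg f (Subsingleton.elim _ _)
    simp [h]
  | succ n ih =>
    set F : X → ℝ := fun a => ∫ y, f (Fin.cons a y) ∂(Measure.pi fun _ : Fin n => P) with hF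
    have hcons : ∀ a, Measurable fun y : Fin n → X => f (Fin.cons a y) := fun a =>
      hf.comp (measurable_finCons.comp (measurable_const.prodMk measurable_id))
    have hFm : Measurable F :=
      (hf.comp measurable_finCons).stronglyMeasurable.integral_prod_right'.measurable
    have hFint : ∀ a, Integrable (fun y => f (Fin.cons a y)) (Measure.pi fun _ : Fin n => P) :=
      fun a => integrable_of_abs_le (hcons a) fun _ => hK _
    have hexp : ∀ x, |Real.exp (t * f x)| ≤ Real.exp (|t| * K) := fun x => by
      rw [Real.abs_exp, Real.exp_le_exp]
      refine (le_abs_self _).trans ?_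
      rw [abs_mul]
      exact mul_le_mul_of_nonneg_left (hK x) (abs_nonneg t)
    have hem : Measurable fun x => Real.exp (t * f x) := by fun_prop
    -- Averaging over the remaining coordinates preserves the difference bound. Holding for all `a`
    -- and `b`, it is two-sided.
    have hFdiff : ∀ a b, F a ≤ F b + c := fun a b => by
      have : F a ≤ ∫ y, (f (Fin.cons b y) + c) ∂(Measure.pi fun _ : Fin n => P) := by
        refine integral_mono (hFint a) ((hFint b).add (integrable_const c)) fun y => ?_
        have := hc (Fin.cons b y) 0 a
        rwa [Fin.update_cons_zero] at this
      rwa [integral_add (hFint b) (integrable_const c), integral_const, probReal_univ,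
        one_smul] at this
    have hinner : ∀ a, ∫ y, Real.exp (t * f (Fin.cons a y)) ∂(Measure.pi fun _ : Fin n => P) ≤
        Real.exp (t * F a) * Real.exp (n * (c ^ 2 * t ^ 2 / 2)) := fun a => by
      rw [← Real.exp_add]
      refine ih (fun y => f (Fin.cons a y)) (hcons a) (fun y => hK _) fun y i b => ?_
      have := hc (Fin.cons a y) i.succ b
      rwa [← Fin.cons_update] at this
    have hFK : ∀ a, |F a| ≤ K := fun a => by
      have := norm_integral_le_of_norm_le_const (μ := Measure.pi fun _ : Fin n => P)
        (f := fun y => f (Fin.cons a y)) (Eventually.of_forall fun y => hK _)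
      simpa using this
    have hFexp : Integrable (fun a => Real.exp (t * F a)) P := by
      refine integrable_of_abs_le (K := Real.exp (|t| * K)) (by fun_prop) fun a => ?_
      rw [Real.abs_exp, Real.exp_le_exp]
      refine (le_abs_self _).trans ?_
      rw [abs_mul]
      exact mul_le_mul_of_nonneg_left (hFK a) (abs_nonneg t)
    obtain ⟨a₀⟩ : Nonempty X := nonempty_of_isProbabilityMeasure P
    -- Hoeffding's lemma on an interval of length `2 * c` centred at `F a₀` gives variance proxy `c
    -- ^ 2`. The shortest interval, of length `c`, would give `c ^ 2 / 4`; the loss is harmless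
    -- here.
    have hsub := hasSubgaussianMGF_of_mem_Icc (μ := P) (X := F) (a := F a₀ - c) (b := F a₀ + c)
      hFm.aemeasurable (Eventually.of_forall fun a =>
        ⟨by linarith [hFdiff a₀ a], hFdiff a a₀⟩)
    have hmgf := hsub.mgf_le t
    have hcc : (((‖F a₀ + c - (F a₀ - c)‖₊ / 2) ^ 2 : ℝ≥0) : ℝ) = c ^ 2 := by
      push_cast
      rw [Real.norm_eq_abs, div_pow, sq_abs]
      ring
    rw [hcc] at hmgf
    have houter : ∫ a, Real.exp (t * F a) ∂P ≤ Real.exp (t * ∫ a, F a ∂P) *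
        Real.exp (c ^ 2 * t ^ 2 / 2) := by
      have hsplit : ∀ a, Real.exp (t * F a) =
          Real.exp (t * ∫ a, F a ∂P) * Real.exp (t * (F a - ∫ a, F a ∂P)) := fun a => by
        rw [← Real.exp_add]; ring_nf
      simp_rw [hsplit]
      rw [integral_const_mul]
      exact mul_le_mul_of_nonneg_left hmgf (Real.exp_pos _).le
    rw [integral_pi_succ P hem hexp, integral_pi_succ P hf hK]
    calc _ ≤ ∫ a, Real.exp (t * F a) * Real.exp (n * (c ^ 2 * t ^ 2 / 2)) ∂P := by
          refine integral_mono ?_ (hFexp.mul_const _) hinner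
          refine integrable_of_abs_le (K := Real.exp (|t| * K))
            ((hem.comp measurable_finCons).stronglyMeasurable.integral_prod_right'.measurable)
            fun a => ?_
          have := norm_integral_le_of_norm_le_const (μ := Measure.pi fun _ : Fin n => P)
            (f := fun y => Real.exp (t * f (Fin.cons a y))) (Eventually.of_forall fun y => hexp _)
          simpa using this
      _ ≤ Real.exp (t * ∫ a, F a ∂P) * Real.exp (c ^ 2 * t ^ 2 / 2) *
          Real.exp (n * (c ^ 2 * t ^ 2 / 2)) := by
          rw [integral_mul_const]
          exact mul_le_mul_of_nonneg_right houter (Real.exp_pos _).le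
      _ = _ := by
          rw [← Real.exp_add, ← Real.exp_add]
          congr 1
          push_cast
          ring

/-- A bounded differences inequality (with a non-optimal exponent). -/
theorem measureReal_ge_le_of_boundedDifferences (P : Measure X) [IsProbabilityMeasure P] {c : ℝ}
    {n : ℕ} {f : (Fin n → X) → ℝ} (hf : Measurable f) {K : ℝ} (hK : ∀ x, |f x| ≤ K)
    (hc : ∀ x i a, f (Function.update x i a) ≤ f x + c) {ε : ℝ} (hε : 0 ≤ ε) :
    (Measure.pi fun _ : Fin n => P).real
        {x | ε ≤ f x - ∫ y, f y ∂(Measure.pi fun _ => P)} ≤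
      Real.exp (-ε ^ 2 / (2 * (n * c ^ 2))) := by
  set M := ∫ y, f y ∂(Measure.pi fun _ : Fin n => P) with hM
  have hcoe : ((Real.toNNReal (n * c ^ 2) : ℝ≥0) : ℝ) = n * c ^ 2 :=
    Real.coe_toNNReal _ (by positivity)
  have hsub : HasSubgaussianMGF (fun x => f x - M) (Real.toNNReal (n * c ^ 2))
      (Measure.pi fun _ : Fin n => P) := by
    refine ⟨fun t => ?_, fun t => ?_⟩
    · refine integrable_of_abs_le (K := Real.exp (|t| * (K + |M|))) (by fun_prop) fun x => ?_
      rw [Real.abs_exp, Real.exp_le_exp]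
      refine (le_abs_self _).trans ?_
      rw [abs_mul]
      exact mul_le_mul_of_nonneg_left ((abs_sub _ _).trans (add_le_add_left (hK x) _))
        (abs_nonneg t)
    · have hsplit : ∀ x, Real.exp (t * (f x - M)) = Real.exp (t * f x) * Real.exp (-(t * M)) :=
        fun x => by rw [← Real.exp_add]; ring_nf
      simp only [mgf, hsplit]
      rw [integral_mul_const]
      refine (mul_le_mul_of_nonneg_right
        (integral_exp_le_of_boundedDifferences P t n f hf hK hc) (Real.exp_pos _).le).trans_eq ?_
      rw [← Real.exp_add, hcoe]
      congr 1
      ring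
  simpa only [hcoe] using hsub.measure_ge_le hε

end McDiarmid

/-! ### Symmetrization by a ghost sample -/

section Symmetrization

variable {X : Type*} {N : ℕ}

theorem signForm_sub (s : Fin N → Bool) (x y : EuclideanSpace ℝ (Fin N)) :
    signForm s (x - y) = signForm s x - signForm s y := by
  simp [signForm, mul_sub, Finset.sum_sub_distrib]

theorem abs_signForm_le (s : Fin N → Bool) (x : EuclideanSpace ℝ (Fin N)) :
    |signForm s x| ≤ N * ‖x‖ := by
  refine abs_le'.2 ⟨signForm_le s x, ?_⟩
  have h := signForm_le s (-x)
  rw [norm_neg, ← zero_sub, signForm_sub, signForm_zero, zero_sub] at h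
  exact h

theorem signForm_not (s : Fin N → Bool) (x : EuclideanSpace ℝ (Fin N)) :
    signForm (fun i => !s i) x = signForm s (-x) := by
  refine Finset.sum_congr rfl fun i _ => ?_
  cases h : s i <;> simp [boolSign, h]

/-- Flipping all signs permutes the patterns. With `signForm_not` this removes a minus sign under
the supremum, although the family need not be symmetric. -/
theorem signAvg_comp_not (F : (Fin N → Bool) → ℝ) :
    signAvg (fun s => F fun i => !s i) = signAvg F := by
  unfold signAvg
  congr 1
  have hinv : Function.Involutive fun (s : Fin N → Bool) (i : Fin N) => !s i :=
    fun s => by simp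
  exact Equiv.sum_comp hinv.toPerm F

theorem norm_toL2Emp_le (S : Fin N → X) {g : X → ℝ} (h : ∀ k, |g (S k)| ≤ 1) :
    ‖toL2Emp S g‖ ≤ 1 := by
  rw [EuclideanSpace.norm_eq, Real.sqrt_le_one]
  have : ∀ k ∈ (Finset.univ : Finset (Fin N)), ‖(toL2Emp S g) k‖ ^ 2 ≤ 1 / N := fun k _ => by
    simp only [toL2Emp, norm_div, Real.norm_eq_abs, div_pow, sq_abs,
      Real.sq_sqrt (Nat.cast_nonneg N)]
    gcongr
    exact (sq_le_one_iff_abs_le_one _).2 (h k)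
  refine (Finset.sum_le_card_nsmul _ _ _ this).trans ?_
  simpa [div_eq_mul_inv] using mul_inv_le_one

/-- The normalized empirical Rademacher average of a family of functions on a sample. -/
def empRademacher {ι : Type*} (v : ι → X → ℝ) (S : Fin N → X) : ℝ :=
  signAvg fun s => ⨆ i, signForm s (toL2Emp S (v i))

theorem measurable_signForm_toL2Emp [MeasurableSpace X]
    (s : Fin N → Bool) {g : X → ℝ} (hg : Measurable g) :
    Measurable fun S : Fin N → X => signForm s (toL2Emp S g) := by
  unfold signForm toL2Emp
  fun_prop

theorem measurable_signAvg {Y : Type*} [MeasurableSpace Y] {F : Y → (Fin N → Bool) → ℝ}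
    (hF : ∀ s, Measurable fun y => F y s) : Measurable fun y => signAvg (F y) := by
  unfold signAvg
  exact (Finset.measurable_fun_sum _ fun s _ => hF s).div_const _

variable {ι : Type*} {v : ι → X → ℝ}

theorem measurable_empRademacher [MeasurableSpace X] [Countable ι]
    (hv : ∀ i, Measurable (v i)) :
    Measurable fun S : Fin N → X => empRademacher v S :=
  measurable_signAvg fun s => Measurable.iSup fun i => measurable_signForm_toL2Emp s (hv i)

theorem abs_signAvg_le {F : (Fin N → Bool) → ℝ} {K : ℝ} (h : ∀ s, |F s| ≤ K) :
    |signAvg F| ≤ K := by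
  rw [abs_le]
  constructor
  · simpa using signAvg_mono (F := fun _ => -K) fun s => (abs_le.1 (h s)).1
  · simpa using signAvg_mono (G := fun _ => K) fun s => (abs_le.1 (h s)).2

theorem abs_empRademacher_le [Finite ι] [Nonempty ι] (hv1 : ∀ i x, |v i x| ≤ 1) (S : Fin N → X) :
    |empRademacher v S| ≤ N :=
  abs_signAvg_le fun _ => abs_ciSup_le fun i => (abs_signForm_le _ _).trans <|
    mul_le_of_le_one_right (Nat.cast_nonneg N) (norm_toL2Emp_le S fun k => hv1 i (S k))

/-- The largest difference of empirical averages over the two halves of a paired sample, with the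
`k`-th pair counted with sign `s k`; normalized by `√N`. -/
def pairedDeviation (v : ι → X → ℝ) (s : Fin N → Bool) (w : Fin N → X × X) : ℝ :=
  ⨆ i, signForm s (toL2Emp (fun k => (w k).2) (v i) - toL2Emp (fun k => (w k).1) (v i))

theorem measurable_pairedDeviation [MeasurableSpace X] [Countable ι]
    (hv : ∀ i, Measurable (v i)) (s : Fin N → Bool) :
    Measurable (pairedDeviation v s) := by
  refine Measurable.iSup fun i => ?_
  simp only [signForm_sub]
  have := hv i
  exact ((measurable_signForm_toL2Emp s (hv i)).comp (by fun_prop)).sub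
    ((measurable_signForm_toL2Emp s (hv i)).comp (by fun_prop))

theorem abs_pairedDeviation_le [Finite ι] [Nonempty ι] (hv1 : ∀ i x, |v i x| ≤ 1) (s : Fin N → Bool)
    (w : Fin N → X × X) : |pairedDeviation v s w| ≤ N * 2 :=
  abs_ciSup_le fun i => (abs_signForm_le _ _).trans <| by
    gcongr
    refine (norm_sub_le _ _).trans ?_
    have h1 := norm_toL2Emp_le (fun k => (w k).2) fun k => hv1 i _
    have h2 := norm_toL2Emp_le (fun k => (w k).1) fun k => hv1 i _
    linarith

/-- Swapping the two halves of the pairs with sign `-1`. -/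
theorem integral_pairedDeviation_eq [MeasurableSpace X] [Countable ι]
    (P : Measure X) [IsProbabilityMeasure P]
    (hv : ∀ i, Measurable (v i)) (s : Fin N → Bool) :
    ∫ w, pairedDeviation v s w ∂(Measure.pi fun _ : Fin N => P.prod P) =
      ∫ w, pairedDeviation v (fun _ => true) w ∂(Measure.pi fun _ : Fin N => P.prod P) := by
  have hmp : MeasurePreserving
      (fun (w : Fin N → X × X) k => (if s k then id else Prod.swap : X × X → X × X) (w k))
      (Measure.pi fun _ : Fin N => P.prod P) (Measure.pi fun _ : Fin N => P.prod P) := by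
    refine measurePreserving_pi _ _ fun k => ?_
    by_cases h : s k
    · simpa [h] using MeasurePreserving.id _
    · simpa [h] using Measure.measurePreserving_swap
  conv_rhs => rw [← hmp.map_eq]
  rw [integral_map hmp.measurable.aemeasurable
    (measurable_pairedDeviation hv _).aestronglyMeasurable]
  refine integral_congr_ae (Eventually.of_forall fun w => ?_)
  simp only [pairedDeviation]
  congr 1
  ext i
  simp only [signForm]
  refine Finset.sum_congr rfl fun k _ => ?_
  by_cases h : s k
  · simp [h, toL2Emp]
  · simp [h, toL2Emp, boolSign]

theorem signAvg_pairedDeviation_le [Finite ι] [Nonempty ι] (w : Fin N → X × X) :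
    signAvg (fun s => pairedDeviation v s w) ≤
      empRademacher v (fun k => (w k).2) + empRademacher v (fun k => (w k).1) := by
  simp only [pairedDeviation, sub_eq_add_neg]
  refine (signAvg_iSup_signForm_add_le _ _).trans_eq ?_
  congr 1
  simp only [← signForm_not]
  exact signAvg_comp_not fun s => ⨆ i, signForm s (toL2Emp (fun k => (w k).1) (v i))

/-- The integral is the same for every sign pattern, hence equals its average over patterns; after
exchanging average and integral, each half of the pairs contributes one Rademacher average. -/
theorem integral_pairedDeviation_le [MeasurableSpace X] [Finite ι] [Nonempty ι]
    (P : Measure X) [IsProbabilityMeasure P]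
    (hv : ∀ i, Measurable (v i)) (hv1 : ∀ i x, |v i x| ≤ 1) :
    ∫ w, pairedDeviation v (fun _ => true) w ∂(Measure.pi fun _ : Fin N => P.prod P) ≤
      2 * ∫ S, empRademacher v S ∂(Measure.pi fun _ : Fin N => P) := by
  set Q := Measure.pi fun _ : Fin N => P.prod P
  have hdev : ∀ s : Fin N → Bool, Integrable (pairedDeviation v s) Q := fun s =>
    integrable_of_abs_le (measurable_pairedDeviation hv s) (abs_pairedDeviation_le hv1 s)
  have hfst : MeasurePreserving (fun (w : Fin N → X × X) k => (w k).1) Q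
      (Measure.pi fun _ => P) := measurePreserving_pi _ _ fun _ => measurePreserving_fst
  have hsnd : MeasurePreserving (fun (w : Fin N → X × X) k => (w k).2) Q
      (Measure.pi fun _ => P) := measurePreserving_pi _ _ fun _ => measurePreserving_snd
  have hrad : Integrable (fun S => empRademacher v S) (Measure.pi fun _ : Fin N => P) :=
    integrable_of_abs_le (measurable_empRademacher hv) (abs_empRademacher_le hv1)
  have h1 : ∫ w, empRademacher v (fun k => (w k).1) ∂Q =
      ∫ S, empRademacher v S ∂(Measure.pi fun _ : Fin N => P) := by
    rw [← hfst.map_eq, integral_map hfst.measurable.aemeasurable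
      (measurable_empRademacher hv).aestronglyMeasurable]
  have h2 : ∫ w, empRademacher v (fun k => (w k).2) ∂Q =
      ∫ S, empRademacher v S ∂(Measure.pi fun _ : Fin N => P) := by
    rw [← hsnd.map_eq, integral_map hsnd.measurable.aemeasurable
      (measurable_empRademacher hv).aestronglyMeasurable]
  have hi1 := hfst.integrable_comp_of_integrable hrad
  have hi2 := hsnd.integrable_comp_of_integrable hrad
  calc _ = signAvg fun s : Fin N → Bool => ∫ w, pairedDeviation v s w ∂Q := by
        simp only [Q, integral_pairedDeviation_eq P hv, signAvg_const]
    _ = ∫ w, signAvg (fun s => pairedDeviation v s w) ∂Q := by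
        simp only [signAvg]
        rw [integral_div, integral_finsetSum _ fun s _ => hdev s]
    _ ≤ ∫ w, (empRademacher v (fun k => (w k).2) + empRademacher v (fun k => (w k).1)) ∂Q := by
        refine integral_mono ?_ (hi2.add hi1) fun w => signAvg_pairedDeviation_le w
        exact integrable_of_abs_le (measurable_signAvg fun s => measurable_pairedDeviation hv s)
          fun w => abs_signAvg_le fun s => abs_pairedDeviation_le hv1 s w
    _ = _ := by
        refine (integral_add hi2 hi1).trans ?_
        simp only [Function.comp_def, h1, h2]
        ring

/-- The uniform deviation of true risks above empirical risks. -/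
def uniformDeviation [MeasurableSpace X] (P : Measure X) (v : ι → X → ℝ) (S : Fin N → X) : ℝ :=
  ⨆ i, (risk P (v i) - empRisk S (v i))

theorem measurable_empRisk [MeasurableSpace X] {g : X → ℝ} (hg : Measurable g) :
    Measurable fun S : Fin N → X => empRisk S g := by
  unfold empRisk
  fun_prop

theorem abs_empRisk_le (S : Fin N → X) {g : X → ℝ} (hg : ∀ k, |g (S k)| ≤ 1) :
    |empRisk S g| ≤ 1 := by
  rw [empRisk, abs_div, Nat.abs_cast]
  refine div_le_one_of_le₀ ((Finset.abs_sum_le_sum_abs _ _).trans ?_) (Nat.cast_nonneg N)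
  simpa using Finset.sum_le_card_nsmul Finset.univ (fun k => |g (S k)|) 1 fun k _ => hg k

theorem abs_risk_le [MeasurableSpace X]
    (P : Measure X) [IsProbabilityMeasure P] {g : X → ℝ} (hg : ∀ x, |g x| ≤ 1) :
    |risk P g| ≤ 1 := by
  simpa [risk] using norm_integral_le_of_norm_le_const (μ := P) (f := g) (Eventually.of_forall hg)

theorem integral_empRisk [MeasurableSpace X]
    (hN : 0 < N) (P : Measure X) [IsProbabilityMeasure P] {g : X → ℝ}
    (hg : Measurable g) (hg1 : ∀ x, |g x| ≤ 1) :
    ∫ S, empRisk S g ∂(Measure.pi fun _ : Fin N => P) = risk P g := by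
  have heval : ∀ k : Fin N, ∫ S, g (S k) ∂(Measure.pi fun _ : Fin N => P) = risk P g := fun k => by
    have hmp := measurePreserving_eval (fun _ : Fin N => P) k
    have h := integral_map (μ := Measure.pi fun _ : Fin N => P) hmp.measurable.aemeasurable
      hg.aestronglyMeasurable
    rw [hmp.map_eq] at h
    exact h.symm
  simp only [empRisk]
  have hint : ∀ k ∈ (Finset.univ : Finset (Fin N)),
      Integrable (fun S : Fin N → X => g (S k)) (Measure.pi fun _ => P) := fun k _ =>
    integrable_of_abs_le (hg.comp (measurable_pi_apply k)) fun S => hg1 _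
  rw [integral_div, integral_finsetSum _ hint]
  simp only [heval, Finset.sum_const, Finset.card_univ, Fintype.card_fin, nsmul_eq_mul]
  field_simp

theorem measurable_uniformDeviation [MeasurableSpace X] [Countable ι]
    (P : Measure X) (hv : ∀ i, Measurable (v i)) :
    Measurable fun S : Fin N → X => uniformDeviation P v S :=
  Measurable.iSup fun i => measurable_const.sub (measurable_empRisk (hv i))

theorem abs_uniformDeviation_le [MeasurableSpace X] [Finite ι] [Nonempty ι]
    (P : Measure X) [IsProbabilityMeasure P]
    (hv1 : ∀ i x, |v i x| ≤ 1) (S : Fin N → X) : |uniformDeviation P v S| ≤ 2 :=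
  abs_ciSup_le fun i => (abs_sub _ _).trans <| by
    linarith [abs_risk_le P (hv1 i), abs_empRisk_le S fun k => hv1 i (S k)]

theorem signForm_true_toL2Emp (S : Fin N → X) (g : X → ℝ) :
    signForm (fun _ => true) (toL2Emp S g) = √N * empRisk S g := by
  simp only [signForm, boolSign, toL2Emp, empRisk, if_true, one_mul, ← Finset.sum_div]
  rcases Nat.eq_zero_or_pos N with rfl | hN
  · simp
  · have h : (N : ℝ) = √N * √N := (Real.mul_self_sqrt (Nat.cast_nonneg N)).symm
    have h' : 0 < √(N : ℝ) := Real.sqrt_pos.2 (by exact_mod_cast hN)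
    rw [div_eq_iff h'.ne']
    conv_rhs => rw [h, Real.sqrt_mul_self h'.le]
    field_simp

/-- Symmetrization: the expected uniform deviation is at most twice the expected Rademacher
average. -/
theorem integral_uniformDeviation_le [MeasurableSpace X] [Finite ι] [Nonempty ι]
    (hN : 0 < N) (P : Measure X) [IsProbabilityMeasure P]
    (hv : ∀ i, Measurable (v i)) (hv1 : ∀ i x, |v i x| ≤ 1) :
    ∫ S, uniformDeviation P v S ∂(Measure.pi fun _ : Fin N => P) ≤
      2 / √N * ∫ S, empRademacher v S ∂(Measure.pi fun _ : Fin N => P) := by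
  set ν := Measure.pi fun _ : Fin N => P
  have hN' : 0 < √(N : ℝ) := Real.sqrt_pos.2 (by exact_mod_cast hN)
  -- A sample of pairs is regrouped as a pair of samples: pairs suit the sign swaps, the sample and
  -- its ghost suit Fubini.
  let e := MeasurableEquiv.arrowProdEquivProdArrow X X (Fin N)
  have he : MeasurePreserving e (Measure.pi fun _ : Fin N => P.prod P) (ν.prod ν) :=
    measurePreserving_arrowProdEquivProdArrow X X (Fin N) (fun _ => P) (fun _ => P)
  set D : (Fin N → X) × (Fin N → X) → ℝ :=
    fun z => pairedDeviation v (fun _ => true) (e.symm z) with hD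
  have hDm : Measurable D := (measurable_pairedDeviation hv _).comp e.symm.measurable
  have hDi : Integrable D (ν.prod ν) :=
    integrable_of_abs_le hDm fun z => abs_pairedDeviation_le hv1 _ _
  have hDeq : ∀ S S', D (S, S') = ⨆ i, (√N * empRisk S' (v i) - √N * empRisk S (v i)) :=
    fun S S' => by
      simp only [hD, pairedDeviation, signForm_sub]
      congr 1
      ext i
      rw [← signForm_true_toL2Emp, ← signForm_true_toL2Emp]
      rfl
  -- The finite supremum is attained at some `i`. The ghost empirical risk of that function
  -- integrates to its true risk, and its gap is at most the supremum inside the integral.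
  have hpt : ∀ S, √N * uniformDeviation P v S ≤ ∫ S', D (S, S') ∂ν := fun S => by
    obtain ⟨i, hi⟩ := exists_eq_ciSup_of_finite (f := fun i => risk P (v i) - empRisk S (v i))
    rw [uniformDeviation, ← hi]
    have hint : Integrable (fun S' : Fin N → X => √N * empRisk S' (v i)) ν :=
      (integrable_of_abs_le (measurable_empRisk (hv i))
        fun S' => abs_empRisk_le S' fun k => hv1 i _).const_mul _
    calc _ = ∫ S', (√N * empRisk S' (v i) - √N * empRisk S (v i)) ∂ν := by
          rw [integral_sub hint (integrable_const _), integral_const_mul, integral_const,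
            integral_empRisk hN P (hv i) (hv1 i)]
          simp [mul_sub]
      _ ≤ _ := by
          refine integral_mono (hint.sub (integrable_const _)) (integrable_of_abs_le
            (hDm.comp measurable_prodMk_left) fun _ => abs_pairedDeviation_le hv1 _ _) fun S' => ?_
          simp only [hDeq]
          exact le_ciSup (f := fun i => √N * empRisk S' (v i) - √N * empRisk S (v i))
            (Set.finite_range _).bddAbove i
  have hmain : √N * ∫ S, uniformDeviation P v S ∂ν ≤ 2 * ∫ S, empRademacher v S ∂ν := by
    calc _ = ∫ S, √N * uniformDeviation P v S ∂ν := (integral_const_mul _ _).symm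
      _ ≤ ∫ S, ∫ S', D (S, S') ∂ν ∂ν :=
          integral_mono ((integrable_of_abs_le (measurable_uniformDeviation P hv)
            (abs_uniformDeviation_le P hv1)).const_mul _) hDi.integral_prod_left hpt
      _ = ∫ z, D z ∂(ν.prod ν) := (integral_prod D hDi).symm
      _ = ∫ w, pairedDeviation v (fun _ => true) w ∂(Measure.pi fun _ : Fin N => P.prod P) := by
          rw [← he.integral_comp']
          simp [hD]
      _ ≤ _ := integral_pairedDeviation_le P hv hv1
  rw [div_mul_eq_mul_div, le_div_iff₀ hN']
  linarith

end Symmetrization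

/-! ### Uniform law for one class -/

section UniformLaw

variable {X : Type*} {N : ℕ}

theorem EntropyGrowth.exists_finset_cover {A : ℝ} (hA : 1 ≤ A) {m : ℕ} {G : Set (X → ℝ)}
    {S : Fin N → X} (h : EntropyGrowth A m G S) (j : ℕ) :
    ∃ C : Finset (EuclideanSpace ℝ (Fin N)),
      (C.card : ℝ) ≤ Real.exp (m * (Real.log A + j * Real.log 2)) ∧
        ∀ g ∈ G, ∃ x ∈ C, ‖x - toL2Emp S g‖ ≤ 1 / 2 ^ j := by
  have hε : (((1 / 2 : ℝ≥0) ^ j : ℝ≥0) : ℝ) = 1 / 2 ^ j := by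
    push_cast
    rw [one_div_pow]
  have hj := h ((1 / 2) ^ j) (by positivity) (pow_le_one₀ (by positivity) (by norm_num))
  have hlog : (m : ℝ) * Real.log (A / ((1 / 2 : ℝ≥0) ^ j : ℝ≥0)) =
      m * (Real.log A + j * Real.log 2) := by
    rw [hε, Real.log_div (by positivity) (by positivity), one_div, Real.log_inv, Real.log_pow]
    ring
  rw [hlog, ← Real.log_exp (m * (Real.log A + j * Real.log 2)),
    ← ENNReal.log_ofReal_of_pos (Real.exp_pos _), ENNReal.log_le_log_iff] at hj
  -- An infimum of extended natural numbers is attained, so an optimal cover exists.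
  obtain ⟨C, hC, hCe⟩ : ∃ C : Set (EuclideanSpace ℝ (Fin N)),
      Metric.IsCover ((1 / 2) ^ j) (toL2Emp S '' G) C ∧
        C.encard = coveringNumber ((1 / 2) ^ j) G S := by
    have : Nonempty {C // Metric.IsCover ((1 / 2 : ℝ≥0) ^ j) (toL2Emp S '' G) C} :=
      ⟨⟨_, Metric.IsCover.refl _ _⟩⟩
    obtain ⟨⟨C, hC⟩, hCe⟩ := ENat.exists_eq_iInf
      (fun C : {C // Metric.IsCover ((1 / 2 : ℝ≥0) ^ j) (toL2Emp S '' G) C} => C.1.encard)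
    refine ⟨C, hC, hCe.trans ?_⟩
    rw [coveringNumber, Metric.externalCoveringNumber, iInf_subtype]
  rw [← hCe] at hj
  have hfin : C.Finite := by
    rw [← Set.encard_ne_top_iff]
    intro htop
    simp [htop] at hj
  refine ⟨hfin.toFinset, ?_, fun g hg => ?_⟩
  · rw [hfin.encard_eq_coe_toFinset_card] at hj
    rw [← ENNReal.ofReal_le_ofReal_iff (Real.exp_pos _).le, ENNReal.ofReal_natCast]
    simpa using hj
  · obtain ⟨x, hx, hxg⟩ := hC (Set.mem_image_of_mem _ hg)
    refine ⟨x, by simpa using hx, ?_⟩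
    rw [← dist_eq_norm, dist_comm, ← hε]
    have : edist (toL2Emp S g) x ≤ (((1 / 2) ^ j : ℝ≥0) : ℝ≥0∞) := hxg
    rwa [edist_nndist, ENNReal.coe_le_coe] at this

/-- Agreement with members of `G` on the sample suffices, which leaves room for the truncated losses
used later. -/
theorem empRademacher_le_of_entropyGrowth {ι : Type*} [Finite ι] [Nonempty ι] {A : ℝ} (hA : 1 ≤ A)
    {m : ℕ} (hm : 0 < m) {G : Set (X → ℝ)} {S : Fin N → X} (h : EntropyGrowth A m G S)
    {v : ι → X → ℝ} (hv1 : ∀ i x, |v i x| ≤ 1) (hvG : ∀ i, ∃ g ∈ G, ∀ k, v i (S k) = g (S k)) :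
    empRademacher v S ≤ 6 * A * √(Real.pi * m) := by
  refine signAvg_iSup_signForm_le_of_cover hm hA _
    (fun i => norm_toL2Emp_le S fun k => hv1 i _) fun j => ?_
  obtain ⟨C, hCcard, hC⟩ := h.exists_finset_cover hA j
  refine ⟨C, hCcard, fun i => ?_⟩
  obtain ⟨g, hg, hvg⟩ := hvG i
  have : toL2Emp S (v i) = toL2Emp S g := by simp [toL2Emp, hvg]
  rw [this]
  exact hC g hg

theorem empRisk_le_empRisk_update (S : Fin N → X) {g : X → ℝ} (h0 : ∀ x, 0 ≤ g x)
    (h1 : ∀ x, g x ≤ 1) (k : Fin N) (a : X) :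
    empRisk S g ≤ empRisk (Function.update S k a) g + 1 / N := by
  unfold empRisk
  rw [← add_div]
  gcongr
  rw [Fintype.sum_eq_add_sum_compl k, Fintype.sum_eq_add_sum_compl k,
    Function.update_self]
  have : ∑ i ∈ {k}ᶜ, g (Function.update S k a i) = ∑ i ∈ {k}ᶜ, g (S i) :=
    Finset.sum_congr rfl fun i hi => by
      rw [Function.update_of_ne (by simpa using hi)]
  rw [this]
  linarith [h0 a, h1 (S k)]

variable [MeasurableSpace X]

/-- Bounded differences with `c = 1 / N` control the excess over the mean, and symmetrization bounds
the mean. -/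
theorem measureReal_uniformDeviation_le {ι : Type*} [Finite ι] [Nonempty ι] (hN : 0 < N)
    (P : Measure X) [IsProbabilityMeasure P] {v : ι → X → ℝ} (hv : ∀ i, Measurable (v i))
    (h0 : ∀ i x, 0 ≤ v i x) (h1 : ∀ i x, v i x ≤ 1) {K : ℝ}
    (hrad : ∀ᵐ S ∂(Measure.pi fun _ : Fin N => P), empRademacher v S ≤ K) {ε : ℝ} (hε : 0 ≤ ε) :
    (Measure.pi fun _ : Fin N => P).real {S | 2 / √N * K + ε ≤ uniformDeviation P v S} ≤
      Real.exp (-(N * ε ^ 2 / 2)) := by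
  have hv1 : ∀ i x, |v i x| ≤ 1 := fun i x => by rw [abs_of_nonneg (h0 i x)]; exact h1 i x
  have hE : ∫ S, uniformDeviation P v S ∂(Measure.pi fun _ : Fin N => P) ≤ 2 / √N * K := by
    refine (integral_uniformDeviation_le hN P hv hv1).trans ?_
    gcongr
    calc _ ≤ ∫ _, K ∂(Measure.pi fun _ : Fin N => P) :=
          integral_mono_ae (integrable_of_abs_le (measurable_empRademacher hv)
            (abs_empRademacher_le hv1)) (integrable_const K) hrad
      _ = K := by simp
  have hdiff : ∀ (S : Fin N → X) k a,
      uniformDeviation P v (Function.update S k a) ≤ uniformDeviation P v S + 1 / N :=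
    fun S k a => by
      refine ciSup_le fun i => ?_
      have h2 := le_ciSup (f := fun i => risk P (v i) - empRisk S (v i))
        (Set.finite_range _).bddAbove i
      have h3 := empRisk_le_empRisk_update S (h0 i) (h1 i) k a
      simp only [uniformDeviation]
      linarith
  have h := measureReal_ge_le_of_boundedDifferences P (measurable_uniformDeviation P hv)
    (abs_uniformDeviation_le P hv1) hdiff hε
  have hN' : (0 : ℝ) < N := by exact_mod_cast hN
  have hexp : -ε ^ 2 / (2 * (N * (1 / (N : ℝ)) ^ 2)) = -(N * ε ^ 2 / 2) := by
    field_simp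
  rw [hexp] at h
  refine (measureReal_mono fun S hS => ?_).trans h
  simp only [Set.mem_ofPred_eq] at hS ⊢
  linarith

/-- Uniform deviation bound for a sequence of functions. -/
theorem measure_exists_deviation_le (hN : 0 < N) (P : Measure X) [IsProbabilityMeasure P]
    {v : ℕ → X → ℝ} (hv : ∀ n, Measurable (v n)) (h0 : ∀ n x, 0 ≤ v n x) (h1 : ∀ n x, v n x ≤ 1)
    {K : ℝ} (hrad : ∀ n, ∀ᵐ S ∂(Measure.pi fun _ : Fin N => P),
      empRademacher (fun i : Fin (n + 1) => v i) S ≤ K) {ε : ℝ} (hε : 0 ≤ ε) :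
    (Measure.pi fun _ : Fin N => P) {S | ∃ n, 2 / √N * K + ε ≤ risk P (v n) - empRisk S (v n)} ≤
      ENNReal.ofReal (Real.exp (-(N * ε ^ 2 / 2))) := by
  -- Failures among the first `n + 1` functions form increasing events, and their bound does not
  -- depend on `n`.
  set B : ℕ → Set (Fin N → X) :=
    fun n => {S | ∃ k ≤ n, 2 / √N * K + ε ≤ risk P (v k) - empRisk S (v k)} with hB
  have hmono : Monotone B := fun n n' hn S ⟨k, hk, h⟩ => ⟨k, hk.trans hn, h⟩
  have hU : {S : Fin N → X | ∃ n, 2 / √N * K + ε ≤ risk P (v n) - empRisk S (v n)} = ⋃ n, B n := by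
    ext S
    simp only [hB, Set.mem_ofPred_eq, Set.mem_iUnion]
    exact ⟨fun ⟨n, h⟩ => ⟨n, n, le_rfl, h⟩, fun ⟨_, k, _, h⟩ => ⟨k, h⟩⟩
  rw [hU, hmono.measure_iUnion]
  refine iSup_le fun n => ?_
  rw [← ofReal_measureReal]
  refine ENNReal.ofReal_le_ofReal ?_
  refine (measureReal_mono ?_).trans (measureReal_uniformDeviation_le hN P
    (v := fun i : Fin (n + 1) => v i) (fun i => hv i) (fun i => h0 i) (fun i => h1 i)
    (hrad n) hε)
  rintro S ⟨k, hk, h⟩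
  exact h.trans (le_ciSup (f := fun i : Fin (n + 1) => risk P (v i) - empRisk S (v i))
    (Set.finite_range _).bddAbove ⟨k, Nat.lt_succ_of_le hk⟩)

/-- The exponent is `9 / 4 * log (8 / δ)`, so the factor `3` more than absorbs the non-optimal
constant of the concentration bound. -/
theorem exp_neg_deviation_le (hN : 0 < N) {δ : ℝ} (hδ0 : 0 < δ) (hδ1 : δ < 1) :
    Real.exp (-(N * (3 * √(Real.log (8 / δ) / (2 * N))) ^ 2 / 2)) ≤ δ / 4 := by
  have hN' : (0 : ℝ) < N := by exact_mod_cast hN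
  have hlog : 0 ≤ Real.log (8 / δ) := Real.log_nonneg (by rw [le_div_iff₀ hδ0]; linarith)
  have hx : N * (3 * √(Real.log (8 / δ) / (2 * N))) ^ 2 / 2 = 9 / 4 * Real.log (8 / δ) := by
    rw [mul_pow, Real.sq_sqrt (by positivity)]
    field_simp
    ring
  rw [hx]
  calc _ ≤ Real.exp (-Real.log (8 / δ)) := Real.exp_le_exp.2 (by linarith)
    _ = δ / 8 := by rw [Real.exp_neg, Real.exp_log (by positivity), inv_div]
    _ ≤ δ / 4 := by linarith

/-- One-sided uniform law for a class of `[0, 1]`-valued functions with polynomial covering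
numbers. -/
theorem exists_event_risk_le (hN : 0 < N) {A δ : ℝ} (hA : 1 ≤ A) (hδ0 : 0 < δ) (hδ1 : δ < 1)
    {Ω : Type*} [MeasurableSpace Ω] (μ : Measure Ω) [IsProbabilityMeasure μ]
    (P : Measure X) [IsProbabilityMeasure P] (Z : Fin N → Ω → X) (hZmeas : ∀ i, Measurable (Z i))
    (hZindep : iIndepFun Z μ) (hZlaw : ∀ i, μ.map (Z i) = P) {m : ℕ} (hm : 0 < m)
    (G : Set (X → ℝ)) (hGm : ∀ g ∈ G, Measurable g) (hG0 : ∀ g ∈ G, ∀ z, 0 ≤ g z)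
    (hG1 : ∀ g ∈ G, ∀ᵐ z ∂P, g z ≤ 1) (hGs : PointwiseSeparable G)
    (hGc : ∀ᵐ ω ∂μ, EntropyGrowth A m G (fun i => Z i ω)) :
    ∃ E : Set Ω, MeasurableSet E ∧ μ Eᶜ ≤ ENNReal.ofReal (δ / 4) ∧ ∀ ω ∈ E, ∀ g ∈ G,
      risk P g ≤ empRisk (fun i => Z i ω) g + 12 * A * √(Real.pi * m) / √N
        + 3 * √(Real.log (8 / δ) / (2 * N)) := by
  obtain ⟨G₀, hG₀G, hG₀c, hlim⟩ := hGs
  rcases G₀.eq_empty_or_nonempty with hemp | hne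
  · refine ⟨Set.univ, MeasurableSet.univ, by simp, fun ω _ g hg => ?_⟩
    obtain ⟨u, hu, -⟩ := hlim g hg
    simpa [hemp] using hu 0
  obtain ⟨u, rfl⟩ := hG₀c.exists_eq_range hne
  have huG : ∀ n, u n ∈ G := fun n => hG₀G ⟨n, rfl⟩
  -- The losses are at most `1` only almost surely. Truncation makes this hold everywhere and
  -- changes no true risk.
  set v : ℕ → X → ℝ := fun n x => min (u n x) 1 with hv
  have hvm : ∀ n, Measurable (v n) := fun n => (hGm _ (huG n)).min measurable_const
  have hv0 : ∀ n x, 0 ≤ v n x := fun n x => le_min (hG0 _ (huG n) x) zero_le_one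
  have hv1 : ∀ n x, v n x ≤ 1 := fun n x => min_le_right _ _
  have hvu : ∀ n, v n =ᵐ[P] u n := fun n => by
    filter_upwards [hG1 _ (huG n)] with z hz using min_eq_left hz
  have hZm : Measurable fun ω i => Z i ω := measurable_pi_iff.2 hZmeas
  have hlaw : μ.map (fun ω i => Z i ω) = Measure.pi fun _ => P := by
    rw [(iIndepFun_iff_map_fun_eq_pi_map fun i => (hZmeas i).aemeasurable).1 hZindep]
    simp only [hZlaw]
  have hle1 : ∀ᵐ ω ∂μ, ∀ n i, u n (Z i ω) ≤ 1 := by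
    refine ae_all_iff.2 fun n => ae_all_iff.2 fun i => ?_
    have := hG1 _ (huG n)
    rw [← hZlaw i] at this
    exact ae_of_ae_map (hZmeas i).aemeasurable this
  set K := 6 * A * √(Real.pi * m) with hK
  set ε := 3 * √(Real.log (8 / δ) / (2 * N)) with hε
  have hrad : ∀ n, ∀ᵐ S ∂(Measure.pi fun _ : Fin N => P),
      empRademacher (fun i : Fin (n + 1) => v i) S ≤ K := fun n => by
    -- The entropy event is not known to be measurable. The Rademacher event is, so the bound is
    -- derived on `Ω` and this event is carried to the product law.
    have hset : MeasurableSet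
        {S : Fin N → X | empRademacher (fun i : Fin (n + 1) => v i) S ≤ K} :=
      measurableSet_le (measurable_empRademacher fun i => hvm i) measurable_const
    rw [← hlaw, ae_map_iff hZm.aemeasurable hset]
    filter_upwards [hGc, hle1] with ω hω hω1
    exact empRademacher_le_of_entropyGrowth hA hm hω
      (fun i x => by rw [abs_of_nonneg (hv0 i x)]; exact hv1 i x)
      fun i => ⟨u i, huG i, fun k => min_eq_left (hω1 i k)⟩
  have hbad := measure_exists_deviation_le hN P hvm hv0 hv1 hrad (ε := ε) (by positivity)
  set Bad : Set (Fin N → X) := {S | ∃ n, 2 / √N * K + ε ≤ risk P (v n) - empRisk S (v n)}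
  have hBadm : MeasurableSet Bad := by
    have : Bad = ⋃ n, {S | 2 / √N * K + ε ≤ risk P (v n) - empRisk S (v n)} := by
      ext S; simp [Bad]
    rw [this]
    exact MeasurableSet.iUnion fun n =>
      measurableSet_le measurable_const (measurable_const.sub (measurable_empRisk (hvm n)))
  set E₁ : Set Ω := {ω | ∀ n i, u n (Z i ω) ≤ 1} with hE₁
  have hE₁m : MeasurableSet E₁ := by
    simp only [hE₁, Set.ofPred_forall]
    exact MeasurableSet.iInter fun n => MeasurableSet.iInter fun i =>
      measurableSet_le ((hGm _ (huG n)).comp (hZmeas i)) measurable_const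
  refine ⟨E₁ ∩ (fun ω i => Z i ω) ⁻¹' Badᶜ, hE₁m.inter (hZm hBadm.compl), ?_, ?_⟩
  · rw [Set.compl_inter]
    refine (measure_union_le _ _).trans ?_
    have h1 : μ E₁ᶜ = 0 := hle1
    rw [h1, zero_add, Set.preimage_compl, compl_compl, ← Measure.map_apply hZm hBadm, hlaw]
    exact hbad.trans (ENNReal.ofReal_le_ofReal (exp_neg_deviation_le hN hδ0 hδ1))
  · rintro ω ⟨hω1, hω2⟩ g hg
    have hu : ∀ n, risk P (u n) ≤ empRisk (fun i => Z i ω) (u n) + (2 / √N * K + ε) := fun n => by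
      have h1 : risk P (u n) = risk P (v n) := integral_congr_ae (hvu n).symm
      have h2 : empRisk (fun i => Z i ω) (u n) = empRisk (fun i => Z i ω) (v n) := by
        simp only [empRisk, hv, min_eq_left (hω1 n _)]
      have h3 : ¬ (2 / √N * K + ε ≤ risk P (v n) - empRisk (fun i => Z i ω) (v n)) :=
        fun h => hω2 ⟨n, h⟩
      rw [h1, h2]
      linarith
    -- The event was fixed by the countable subclass alone; on it the inequality passes to the
    -- pointwise limit, the true risks converging by domination by `1`.
    obtain ⟨w, hw, hwlim⟩ := hlim g hg
    have hemp : Tendsto (fun n => empRisk (fun i => Z i ω) (w n)) atTop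
        (𝓝 (empRisk (fun i => Z i ω) g)) :=
      (tendsto_finsetSum _ fun i _ => hwlim (Z i ω)).div_const _
    have hrisk : Tendsto (fun n => risk P (w n)) atTop (𝓝 (risk P g)) := by
      refine tendsto_integral_of_dominated_convergence (fun _ => 1)
        (fun n => (hGm _ (hG₀G (hw n))).aestronglyMeasurable) (integrable_const 1) (fun n => ?_)
        (Eventually.of_forall hwlim)
      filter_upwards [hG1 _ (hG₀G (hw n))] with z hz
      rwa [Real.norm_eq_abs, abs_of_nonneg (hG0 _ (hG₀G (hw n)) z)]
    have hfin := le_of_tendsto_of_tendsto' hrisk (hemp.add_const (2 / √N * K + ε)) fun n => by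
      obtain ⟨k, hk⟩ := hw n
      rw [← hk]
      exact hu k
    refine hfin.trans_eq ?_
    rw [hK]
    ring

end UniformLaw

/-! ### The normalized squared loss -/

section NormalizedLoss

theorem normLoss_nonneg (B : ℝ) {n : ℕ} (u v : Vec n) : 0 ≤ normLoss B u v := by
  unfold normLoss
  positivity

/-- Each coordinate of the difference is at most `2 * B` in size, which explains the normalization
by `4 * B ^ 2 * n`. -/
theorem normLoss_le_one {B : ℝ} (hB : 0 < B) {n : ℕ} {u v : Vec n} (hu : supNorm u ≤ B)
    (hv : supNorm v ≤ B) : normLoss B u v ≤ 1 := by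
  refine div_le_one_of_le₀ ?_ (by positivity)
  rw [EuclideanSpace.norm_sq_eq]
  have h : ∀ i ∈ (Finset.univ : Finset (Fin n)), ‖(u - v) i‖ ^ 2 ≤ 4 * B ^ 2 := fun i _ => by
    have h1 : ‖u i‖ ≤ B := (norm_le_pi_norm (WithLp.ofLp u) i).trans hu
    have h2 : ‖v i‖ ≤ B := (norm_le_pi_norm (WithLp.ofLp v) i).trans hv
    have h3 : ‖(u - v) i‖ ≤ 2 * B := (norm_sub_le (u i) (v i)).trans (by linarith)
    calc _ ≤ (2 * B) ^ 2 := by gcongr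
      _ = _ := by ring
  refine (Finset.sum_le_card_nsmul _ _ _ h).trans_eq ?_
  simp
  ring

theorem measurable_normLoss {Y : Type*} [MeasurableSpace Y] (B : ℝ) {n : ℕ} {f g : Y → Vec n}
    (hf : Measurable f) (hg : Measurable g) : Measurable fun y => normLoss B (f y) (g y) := by
  unfold normLoss
  fun_prop

end NormalizedLoss

theorem sqrt_add_sqrt_lt {a b d : ℝ} (ha : 0 ≤ a) (hb : 0 ≤ b) (had : a < d) (hbd : b < d) :
    √a + √b < 2 * √d := by
  linarith [Real.sqrt_lt_sqrt ha had, Real.sqrt_lt_sqrt hb hbd]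

/-! ### Combining the branches -/

section Combination

variable {dL dH : ℕ}

theorem measurable_lossDirL (B : ℝ) {f : State dL dH → Vec dL} (hf : Measurable f) :
    Measurable (lossDirL B f) :=
  measurable_normLoss B (hf.comp measurable_fst) (measurable_fst.comp measurable_snd)

theorem measurable_lossDirH (B : ℝ) {f : State dL dH → Vec dH} (hf : Measurable f) :
    Measurable (lossDirH B f) :=
  measurable_normLoss B (hf.comp measurable_fst) (measurable_snd.comp measurable_snd)

theorem measurable_lossDecL (B : ℝ) {g : Vec dL → Vec dL} (hg : Measurable g) :
    Measurable (lossDecL B g : Sample dL dH → ℝ) :=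
  measurable_normLoss B (hg.comp (measurable_fst.comp measurable_fst))
    (measurable_fst.comp measurable_snd)

theorem measurable_lossDecH (B : ℝ) {g : Vec dL × Vec dH → Vec dH} (hg : Measurable g) :
    Measurable (lossDecH B g) :=
  measurable_normLoss B
    (hg.comp ((measurable_fst.comp measurable_snd).prodMk (measurable_snd.comp measurable_fst)))
    (measurable_snd.comp measurable_snd)

theorem sqrt_deviation_add_self (x : ℝ) {N : ℕ} (hN : 0 < N) :
    3 * √(x / (2 * N)) + 3 * √(x / (2 * N)) = 3 * √(2 * x / N) := by
  have hN' : (0 : ℝ) < N := by exact_mod_cast hN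
  have h : 2 * x / N = 2 ^ 2 * (x / (2 * N)) := by
    ring
  rw [h, Real.sqrt_mul (by norm_num), Real.sqrt_sq (by norm_num)]
  ring

theorem measure_inter_four_ge {Ω : Type*} [MeasurableSpace Ω] (μ : Measure Ω)
    [IsProbabilityMeasure μ] {δ : ℝ} (hδ0 : 0 < δ) {E₁ E₂ E₃ E₄ : Set Ω}
    (hm₁ : MeasurableSet E₁) (hm₂ : MeasurableSet E₂) (hm₃ : MeasurableSet E₃)
    (hm₄ : MeasurableSet E₄) (h₁ : μ E₁ᶜ ≤ ENNReal.ofReal (δ / 4))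
    (h₂ : μ E₂ᶜ ≤ ENNReal.ofReal (δ / 4)) (h₃ : μ E₃ᶜ ≤ ENNReal.ofReal (δ / 4))
    (h₄ : μ E₄ᶜ ≤ ENNReal.ofReal (δ / 4)) :
    ENNReal.ofReal (1 - δ) ≤ μ (E₁ ∩ E₂ ∩ (E₃ ∩ E₄)) := by
  have hm := (hm₁.inter hm₂).inter (hm₃.inter hm₄)
  have hc : μ (E₁ ∩ E₂ ∩ (E₃ ∩ E₄))ᶜ ≤ ENNReal.ofReal δ := by
    simp only [Set.compl_inter]
    refine (measure_union_le _ _).trans ((add_le_add ((measure_union_le _ _).trans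
      (add_le_add h₁ h₂)) ((measure_union_le _ _).trans (add_le_add h₃ h₄))).trans_eq ?_)
    rw [← ENNReal.ofReal_add (by positivity) (by positivity),
      ← ENNReal.ofReal_add (by positivity) (by positivity)]
    congr 1
    ring
  have h := prob_compl_eq_one_sub (μ := μ) hm.compl
  rw [compl_compl] at h
  rw [h, ENNReal.ofReal_sub _ hδ0.le, ENNReal.ofReal_one]
  exact tsub_le_tsub_left hc 1

end Combination

end Decoupling

end

/-! ### The generalization comparison -/

theorem mainTheorem3
    {dL dH kL N : ℕ} (hkL : kL < dL) (hdH : 0 < dH) (hN : 0 < N)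
    {A B δ : ℝ} (hA : 1 ≤ A) (hB : 0 < B) (hδ0 : 0 < δ) (hδ1 : δ < 1)
    -- the i.i.d. sample, with common law `P`
    {Ω : Type*} [MeasurableSpace Ω] (μ : Measure Ω) [IsProbabilityMeasure μ]
    (P : Measure (Decoupling.Sample dL dH))
    (Z : Fin N → Ω → Decoupling.Sample dL dH)
    (hZmeas : ∀ i, Measurable (Z i)) (hZindep : iIndepFun Z μ) (hZlaw : ∀ i, μ.map (Z i) = P)
    -- the function classes, consisting of measurable predictors
    (FdirL : Set (Decoupling.State dL dH → Decoupling.Vec dL))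
    (FdirH : Set (Decoupling.State dL dH → Decoupling.Vec dH))
    (FdecL : Set (Decoupling.Vec dL → Decoupling.Vec dL))
    (FdecH : Set (Decoupling.Vec dL × Decoupling.Vec dH → Decoupling.Vec dH))
    (hmDirL : ∀ f ∈ FdirL, Measurable f) (hmDirH : ∀ f ∈ FdirH, Measurable f)
    (hmDecL : ∀ g ∈ FdecL, Measurable g) (hmDecH : ∀ g ∈ FdecH, Measurable g)
    -- boundedness of the clean targets and of the predictions
    (hl : ∀ᵐ z ∂P, Decoupling.supNorm (Decoupling.Sample.l z) ≤ B)
    (hh : ∀ᵐ z ∂P, Decoupling.supNorm (Decoupling.Sample.h z) ≤ B)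
    (hbDirL : ∀ f ∈ FdirL, ∀ᵐ z ∂P,
      Decoupling.supNorm (f (Decoupling.Sample.lt z, Decoupling.Sample.ht z)) ≤ B)
    (hbDirH : ∀ f ∈ FdirH, ∀ᵐ z ∂P,
      Decoupling.supNorm (f (Decoupling.Sample.lt z, Decoupling.Sample.ht z)) ≤ B)
    (hbDecL : ∀ g ∈ FdecL, ∀ᵐ z ∂P, Decoupling.supNorm (g (Decoupling.Sample.lt z)) ≤ B)
    (hbDecH : ∀ g ∈ FdecH, ∀ᵐ z ∂P,
      Decoupling.supNorm (g (Decoupling.Sample.l z, Decoupling.Sample.ht z)) ≤ B)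
    -- pointwise separability of the four loss classes
    (hsDirL : Decoupling.PointwiseSeparable (Decoupling.lossDirL B '' FdirL))
    (hsDirH : Decoupling.PointwiseSeparable (Decoupling.lossDirH B '' FdirH))
    (hsDecL : Decoupling.PointwiseSeparable
      ((Decoupling.lossDecL B : _ → Decoupling.Sample dL dH → ℝ) '' FdecL))
    (hsDecH : Decoupling.PointwiseSeparable (Decoupling.lossDecH B '' FdecH))
    -- covering-number growth of the four loss classes
    (hcDirL : ∀ᵐ ω ∂μ, Decoupling.EntropyGrowth A (dL + dH)
      (Decoupling.lossDirL B '' FdirL) (fun i => Z i ω))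
    (hcDirH : ∀ᵐ ω ∂μ, Decoupling.EntropyGrowth A (dL + dH)
      (Decoupling.lossDirH B '' FdirH) (fun i => Z i ω))
    (hcDecL : ∀ᵐ ω ∂μ, Decoupling.EntropyGrowth A dL
      (Decoupling.lossDecL B '' FdecL) (fun i => Z i ω))
    (hcDecH : ∀ᵐ ω ∂μ, Decoupling.EntropyGrowth A (kL + dH)
      (Decoupling.lossDecH B '' FdecH) (fun i => Z i ω)) :
    -- an event of probability at least `1 - δ` on which both uniform bounds hold
    (∃ E : Set Ω, MeasurableSet E ∧ ENNReal.ofReal (1 - δ) ≤ μ E ∧ ∀ ω ∈ E,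
      (∀ f ∈ FdirL ×ˢ FdirH,
        Decoupling.riskDir B P f ≤ Decoupling.empRiskDir B (fun i => Z i ω) f
          + 24 * A * √(Real.pi * ((dL + dH : ℕ) : ℝ)) / √(N : ℝ)
          + 3 * √(2 * Real.log (8 / δ) / N)) ∧
      (∀ g ∈ FdecL ×ˢ FdecH,
        Decoupling.riskDec B P g ≤ Decoupling.empRiskDec B (fun i => Z i ω) g
          + 12 * A * √Real.pi / √(N : ℝ) * (√(dL : ℝ) + √((kL + dH : ℕ) : ℝ))
          + 3 * √(2 * Real.log (8 / δ) / N))) ∧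
    -- the decoupled complexity term is strictly smaller
    12 * A * √Real.pi / √(N : ℝ) * (√(dL : ℝ) + √((kL + dH : ℕ) : ℝ))
      < 24 * A * √(Real.pi * ((dL + dH : ℕ) : ℝ)) / √(N : ℝ) := by
  have hdL : 0 < dL := Nat.zero_lt_of_lt hkL
  have hP : IsProbabilityMeasure P := by
    rw [← hZlaw ⟨0, hN⟩]
    exact Measure.isProbabilityMeasure_map (hZmeas _).aemeasurable
  have hN' : (0 : ℝ) < √(N : ℝ) := Real.sqrt_pos.2 (by exact_mod_cast hN)
  refine ⟨?_, ?_⟩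
  · obtain ⟨E₁, hm₁, hE₁, h₁⟩ := Decoupling.exists_event_risk_le hN hA hδ0 hδ1 μ P Z hZmeas hZindep
      hZlaw (Nat.add_pos_left hdL dH) _
      (Set.forall_mem_image.2 fun f hf => Decoupling.measurable_lossDirL B (hmDirL f hf))
      (Set.forall_mem_image.2 fun f _ z => Decoupling.normLoss_nonneg _ _ _)
      (Set.forall_mem_image.2 fun f hf => by
        filter_upwards [hbDirL f hf, hl] with z h h' using Decoupling.normLoss_le_one hB h h')
      hsDirL hcDirL
    obtain ⟨E₂, hm₂, hE₂, h₂⟩ := Decoupling.exists_event_risk_le hN hA hδ0 hδ1 μ P Z hZmeas hZindep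
      hZlaw (Nat.add_pos_left hdL dH) _
      (Set.forall_mem_image.2 fun f hf => Decoupling.measurable_lossDirH B (hmDirH f hf))
      (Set.forall_mem_image.2 fun f _ z => Decoupling.normLoss_nonneg _ _ _)
      (Set.forall_mem_image.2 fun f hf => by
        filter_upwards [hbDirH f hf, hh] with z h h' using Decoupling.normLoss_le_one hB h h')
      hsDirH hcDirH
    obtain ⟨E₃, hm₃, hE₃, h₃⟩ := Decoupling.exists_event_risk_le hN hA hδ0 hδ1 μ P Z hZmeas hZindep
      hZlaw hdL _
      (Set.forall_mem_image.2 fun g hg => Decoupling.measurable_lossDecL B (hmDecL g hg))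
      (Set.forall_mem_image.2 fun g _ z => Decoupling.normLoss_nonneg _ _ _)
      (Set.forall_mem_image.2 fun g hg => by
        filter_upwards [hbDecL g hg, hl] with z h h' using Decoupling.normLoss_le_one hB h h')
      hsDecL hcDecL
    obtain ⟨E₄, hm₄, hE₄, h₄⟩ := Decoupling.exists_event_risk_le hN hA hδ0 hδ1 μ P Z hZmeas hZindep
      hZlaw (Nat.add_pos_right kL hdH) _
      (Set.forall_mem_image.2 fun g hg => Decoupling.measurable_lossDecH B (hmDecH g hg))
      (Set.forall_mem_image.2 fun g _ z => Decoupling.normLoss_nonneg _ _ _)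
      (Set.forall_mem_image.2 fun g hg => by
        filter_upwards [hbDecH g hg, hh] with z h h' using Decoupling.normLoss_le_one hB h h')
      hsDecH hcDecH
    refine ⟨E₁ ∩ E₂ ∩ (E₃ ∩ E₄), (hm₁.inter hm₂).inter (hm₃.inter hm₄),
      Decoupling.measure_inter_four_ge μ hδ0 hm₁ hm₂ hm₃ hm₄ hE₁ hE₂ hE₃ hE₄, ?_⟩
    rintro ω ⟨⟨hω₁, hω₂⟩, hω₃, hω₄⟩
    -- Returns the deviation term to the sum of one term per branch.
    rw [← Decoupling.sqrt_deviation_add_self _ hN]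
    refine ⟨fun f hf => ?_, fun g hg => ?_⟩
    · have e₁ := h₁ ω hω₁ _ (Set.mem_image_of_mem _ hf.1)
      have e₂ := h₂ ω hω₂ _ (Set.mem_image_of_mem _ hf.2)
      refine (add_le_add e₁ e₂).trans_eq ?_
      rw [Decoupling.empRiskDir]
      ring
    · have e₃ := h₃ ω hω₃ _ (Set.mem_image_of_mem _ hg.1)
      have e₄ := h₄ ω hω₄ _ (Set.mem_image_of_mem _ hg.2)
      refine (add_le_add e₃ e₄).trans_eq ?_
      rw [Decoupling.empRiskDec, Real.sqrt_mul Real.pi_pos.le, Real.sqrt_mul Real.pi_pos.le]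
      ring
  · rw [Real.sqrt_mul Real.pi_pos.le]
    -- Strictness of the two comparisons comes from `0 < dH` and from `kL < dL`, respectively.
    have h : √(dL : ℝ) + √((kL + dH : ℕ) : ℝ) < 2 * √((dL + dH : ℕ) : ℝ) :=
      Decoupling.sqrt_add_sqrt_lt (Nat.cast_nonneg _) (Nat.cast_nonneg _)
        (by exact_mod_cast Nat.lt_add_of_pos_right hdH)
        (by exact_mod_cast Nat.add_lt_add_right hkL dH)
    have hc : 0 < 12 * A * √Real.pi / √(N : ℝ) := by
      have := Real.sqrt_pos.2 Real.pi_pos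
      positivity
    refine (mul_lt_mul_of_pos_left h hc).trans_eq ?_
    ring
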